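/- **Setting.** Fix $\bar b,L,\bar c>0$. Let $\mathcal U_c$ be the set of nondecreasing, concave, $L$-Lipschitz functions $u:[0,\bar b]\to[0,1]$ with $u(0)=0$, $u(\bar b)=1$. A questionnaire $D$ consists of $K\ge 1$ pairs $(W_k,Y_k)$ of lotteries, i.e. finitely supported probability distributions on $[0,\bar b]$. Let $0=y_1<\dots<y_N=\bar b$ be the elements of $\{0,\bar b\}\cup\bigcup_k(\operatorname{supp}W_k\cup\operatorname{supp}Y_k)$, let $\mu_N=\max_{2\le j\le N}(y_j-y_{j-1})$, let $P\in\mathbb R^{K\times(N-1)}$ be the matrix with entries $\mathbb P[W_k=y_j]-\mathbb P[Y_k=y_j]$ ($2\le j\le N$), and let $\Sigma_D=\frac1K P^\top P$. The decision maker has a true utility $u^*\in\mathcal U_c$ and a true scale $\sigma^*\ge 1/\bar c$; the answer is $Z_k=1$ if $\mathbb E[u^*(W_k)]+\varepsilon_{k,1}\ge\mathbb E[u^*(Y_k)]+\varepsilon_{k,2}$ and $Z_k=-1$ otherwise, where all the $\varepsilon_{k,i}$ are independent with the $\mathrm{Gumbel}(0,\sigma^*)$ distribution. A maximum likelihood estimate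 $(\hat u,\hat\sigma)$ is any maximizer of $$\ell(u,\sigma)=-\sum_{k=1}^K\log\Bigl[1+\exp\bigl(-Z_k(\mathbb E[u(W_k)]-\mathbb E[u(Y_k)])/\sigma\bigr)\Bigr]$$ over $u\in\mathcal U_c$ and $\sigma\in[1/\bar c,\infty]$, where $u/\infty=0$. Let $d_K(f,g)=\sup_{y\in[0,\bar b]}|f(y)-g(y)|$ and $\omega=\frac1{2+2\exp(2\bar c)}$. "With probability at least $1-\delta$, $d_K(\hat u/\hat\sigma,u^*/\sigma^*)\le r$" means that, with probability at least $1-\delta$, the inequality holds for every maximum likelihood estimate. **(a)** Suppose $\lambda_{\min}(\Sigma_D)=\bar\lambda>0$. For every $\delta\in(0,1)$, with probability at least $1-\delta$, $$d_K\Bigl(\frac{\hat u}{\hat\sigma},\frac{u^*}{\sigma^*}\Bigr)\le L\bar c\,\mu_N+\frac{2}{\sqrt{\bar\lambda}}\sqrt{\frac{N-1+2\sqrt{-(N-1)\log\delta}-2\log\delta}{\omega^2K}} .$$ Moreover, if $\mu_N\le A/N$, then for every $\delta\in(0,1)$, with probability at least $1-\delta$, $$d_K\Bigl(\frac{\hat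 u}{\hat\sigma},\frac{u^*}{\sigma^*}\Bigr)\le \frac{C_1}{N}+\frac{C_2}{\sqrt{\bar\lambda}}\sqrt{\frac NK},$$ where $C_1$ depends only on $L,\bar c,A$ and $C_2$ only on $L,\bar c,A,\delta$; for fixed $\bar\lambda$ this is $O(1/N)+O(\sqrt{N/K})$. Consequently, consider a sequence of such questionnaires with $N_n$ breakpoints, $K_n$ queries, mesh $\mu_n$ and $\bar\lambda_n=\lambda_{\min}(\Sigma_{D_n})>0$ (and $\bar b,L,\bar c$ fixed). If $\mu_n=O(1/N_n)$, $N_n\to\infty$, $K_n\to\infty$ and $N_n=o(\bar\lambda_nK_n)$, then $d_K(\hat u/\hat\sigma,u^*/\sigma^*)\to0$ in probability. If $\bar\lambda_n\ge\bar\lambda$ for a constant $\bar\lambda>0$, $\mu_n\le A/N_n$ for all $n$, and $N_n=o(K_n)$, then for every $\eta>0$ the probability that $d_K(\hat u/\hat\sigma,u^*/\sigma^*)\le L\bar cA/N_n+\eta$ tends to $1$. In both statements the inequality or convergence is uniform over all maximum likelihood estimates. **(b)** Suppose $\lambda_{\min}(\Sigma_D)=0$ and $\mu_N\le A/N$. For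 every $\delta\in(0,1)$, with probability at least $1-\delta$, $$d_K\Bigl(\frac{\hat u}{\hat\sigma},\frac{u^*}{\sigma^*}\Bigr)\le\frac{C_1}{N}+C_2\sqrt{\frac NK}+C_3\,\bar c\sqrt N,$$ where $C_3$ is an absolute constant, $C_1$ depends only on $L,\bar c,A$ and $C_2$ only on $L,\bar c,A,\delta$. -/

import Mathlib

open MeasureTheory ProbabilityTheory Filter Topology Asymptotics
open scoped ENNReal Matrix

noncomputable section

namespace PrefElicit

/-- A lottery with outcomes in `[0, b]`: a finitely supported probability distribution.
`prob y` is the probability of the outcome `y`. -/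
structure Lottery (b : ℝ) where
  prob : ℝ →₀ ℝ
  prob_nonneg : ∀ y, 0 ≤ prob y
  sum_prob : ∑ y ∈ prob.support, prob y = 1
  support_subset : ∀ y ∈ prob.support, y ∈ Set.Icc (0 : ℝ) b

/-- Expected utility of a lottery. -/
def Lottery.expect {b : ℝ} (X : Lottery b) (u : ℝ → ℝ) : ℝ :=
  ∑ y ∈ X.prob.support, X.prob y * u y

/-- The class of von Neumann-Morgenstern utility functions on `[0, b]` that are nondecreasing,
concave, Lipschitz with modulus at most `L` and normalized by `u 0 = 0`, `u b = 1`. Values of `u`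
outside `[0, b]` play no role. -/
structure IsUtility (b L : ℝ) (u : ℝ → ℝ) : Prop where
  mono : MonotoneOn u (Set.Icc 0 b)
  concave : ConcaveOn ℝ (Set.Icc 0 b) u
  lipschitz : LipschitzOnWith L.toNNReal u (Set.Icc 0 b)
  map_zero : u 0 = 0
  map_right : u b = 1

/-- A questionnaire: `K ≥ 1` pairs `(W k, Y k)` of lotteries on `[0, b]`. -/
structure Questionnaire (b : ℝ) where
  K : ℕ
  K_pos : 0 < K
  W : Fin K → Lottery b
  Y : Fin K → Lottery b

namespace Questionnaire

variable {b : ℝ} (D : Questionnaire b)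

/-- The union of `{0, b}` and the supports of all lotteries. -/
def supportSet : Finset ℝ :=
  {0} ∪ (Finset.univ.biUnion fun k => (D.W k).prob.support) ∪
    (Finset.univ.biUnion fun k => (D.Y k).prob.support) ∪ {b}

/-- The number of breakpoints. -/
def N : ℕ := D.supportSet.card

/-- The breakpoints in increasing order (indices start at `0`). -/
def breakpoint (j : Fin D.N) : ℝ := D.supportSet.orderEmbOfFin rfl j

/-- The mesh size, the largest gap between consecutive breakpoints. -/
def mesh : ℝ :=
  ⨆ j : Fin (D.N - 1),
    (D.breakpoint ⟨j.1 + 1, by omega⟩ - D.breakpoint ⟨j.1, by omega⟩)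

/-- Probability-mass difference of the `k`-th pair at the `j`-th breakpoint. -/
def massDiff (k : Fin D.K) (j : Fin D.N) : ℝ :=
  (D.W k).prob (D.breakpoint j) - (D.Y k).prob (D.breakpoint j)

/-- The reduced mass-difference matrix: the first breakpoint is dropped. -/
def reducedMatrix : Matrix (Fin D.K) (Fin (D.N - 1)) ℝ :=
  Matrix.of fun k j => D.massDiff k ⟨j.1 + 1, by omega⟩

/-- The empirical information matrix `(1 / K) Pᵀ P`. -/
def infoMatrix : Matrix (Fin (D.N - 1)) (Fin (D.N - 1)) ℝ :=
  (1 / (D.K : ℝ)) • (D.reducedMatrixᵀ * D.reducedMatrix)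

end Questionnaire

/-- The smallest (real) eigenvalue of a matrix; used for symmetric matrices of positive size. -/
def lambdaMin {m : ℕ} (A : Matrix (Fin m) (Fin m) ℝ) : ℝ :=
  sInf {x : ℝ | Module.End.HasEigenvalue (Matrix.toLin' A) x}

/-- The Gumbel distribution with location `0` and scale `s > 0`, through its density. -/
def gumbelMeasure (s : ℝ) : Measure ℝ :=
  volume.withDensity fun x =>
    ENNReal.ofReal (1 / s * Real.exp (-x / s) * Real.exp (-Real.exp (-x / s)))

/-- The decision maker on the probability space `(Ω, P)`: a true utility function, a true scale
`sigmaStar ≥ 1 / c`, and for the `k`-th query two response errors `eps (k, 0)` (on `W k`) and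
`eps (k, 1)` (on `Y k`), all of them independent and Gumbel distributed with that scale. -/
structure DecisionMaker {b : ℝ} (L c : ℝ) (D : Questionnaire b) {Ω : Type*} [MeasurableSpace Ω]
    (P : Measure Ω) where
  uStar : ℝ → ℝ
  isUtility_uStar : IsUtility b L uStar
  sigmaStar : ℝ
  le_sigmaStar : 1 / c ≤ sigmaStar
  eps : Fin D.K × Fin 2 → Ω → ℝ
  measurable_eps : ∀ i, Measurable (eps i)
  indep_eps : iIndepFun eps P
  law_eps : ∀ i, P.map (eps i) = gumbelMeasure sigmaStar

open Classical in
/-- The observed choice: `1` if the random utility of `W k` is at least that of `Y k`, and `-1`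
otherwise. -/
def DecisionMaker.choice {b L c : ℝ} {D : Questionnaire b} {Ω : Type*} [MeasurableSpace Ω]
    {P : Measure Ω} (M : DecisionMaker L c D P) (k : Fin D.K) (w : Ω) : ℝ :=
  if (D.W k).expect M.uStar + M.eps (k, 0) w ≥ (D.Y k).expect M.uStar + M.eps (k, 1) w
  then 1 else -1

/-- The adjusted utility function `u / s` for a scale `s ∈ (0, ∞]`; it is `0` for `s = ∞`. -/
def adjusted (u : ℝ → ℝ) (s : ℝ≥0∞) (y : ℝ) : ℝ := (s⁻¹).toReal * u y

/-- The log-likelihood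
`- ∑ k, log (1 + exp (- z k * (E[u (W k)] - E[u (Y k)]) / s))` of the choices `z`. -/
def logLikelihood {b : ℝ} (D : Questionnaire b) (z : Fin D.K → ℝ) (u : ℝ → ℝ) (s : ℝ≥0∞) : ℝ :=
  -∑ k, Real.log
    (1 + Real.exp (-z k * ((s⁻¹).toReal * ((D.W k).expect u - (D.Y k).expect u))))

/-- `(u, s)` is a maximum likelihood estimate given the choices `z`: it maximizes the
log-likelihood over utility functions `u` and scales `s ∈ [1 / c, ∞]`. (The scale `∞` makes sure
that a maximizer exists; a maximizer over `[1 / c, ∞)` is also one over `[1 / c, ∞]`, as the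
log-likelihood is continuous in `1 / s`.) -/
structure IsMLE {b : ℝ} (L c : ℝ) (D : Questionnaire b) (z : Fin D.K → ℝ) (u : ℝ → ℝ)
    (s : ℝ≥0∞) : Prop where
  isUtility : IsUtility b L u
  le_scale : ENNReal.ofReal (1 / c) ≤ s
  isMax : ∀ (v : ℝ → ℝ) (t : ℝ≥0∞), IsUtility b L v → ENNReal.ofReal (1 / c) ≤ t →
    logLikelihood D z v t ≤ logLikelihood D z u s

/-- The Kolmogorov distance `sup_{y ∈ [0, b]} |f y - g y|`. -/
def kolmogorovDist (b : ℝ) (f g : ℝ → ℝ) : ℝ :=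
  ⨆ y : Set.Icc (0 : ℝ) b, |f y - g y|

/-- The event that every maximum likelihood estimate `(u, s)` computed from the observed choices
satisfies `kolmogorovDist (u / s) (uStar / sigmaStar) ≤ r`. -/
def DecisionMaker.errorLE {b L c : ℝ} {D : Questionnaire b} {Ω : Type*} [MeasurableSpace Ω]
    {P : Measure Ω} (M : DecisionMaker L c D P) (r : ℝ) : Set Ω :=
  {w | ∀ (u : ℝ → ℝ) (s : ℝ≥0∞), IsMLE L c D (fun k => M.choice k w) u s →
    kolmogorovDist b (adjusted u s) (fun y => M.uStar y / M.sigmaStar) ≤ r}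

/-- The constant `1 / (2 + 2 exp (2 c))`. -/
def omegaConst (c : ℝ) : ℝ := 1 / (2 + 2 * Real.exp (2 * c))

end PrefElicit

end

namespace PrefElicit

/-! ### Strong convexity of the logistic loss -/

/-! The likelihood sees a utility only through the predictors E[u(W_k)] - E[u(Y_k)], divided by the
scale. They are linear in the values of u/σ at the breakpoints and lie in [-c, c], where the
logistic loss has second derivative at least ω. Let Δ be the estimation error at the breakpoints and
ξ the vector of centered choice indicators. Comparing the likelihoods of estimate and truth gives
ω/2 ‖PΔ‖² ≤ ⟨ξ, PΔ⟩ (`basic_inequality`).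

As PΔ lies in the range of P, of dimension d ≤ N - 1, only the projection Πξ onto that range
matters, and ‖PΔ‖ ≤ (2/ω) ‖Πξ‖. The difference of two Gumbel errors is logistic, so ξ has
independent centered entries, each confined to an interval of length 1, and is sub-Gaussian. Writing
exp(t²) as a Gaussian average of exponentials linear in t gives E exp ‖Πξ‖² ≤ 2^(d/2), and Markov's
inequality bounds ‖Πξ‖² by d - log δ (`le_prob_sum_sq_le`).

The smallest eigenvalue turns ‖PΔ‖ into ‖Δ‖ through λK‖Δ‖² ≤ ‖PΔ‖². Monotonicity and the Lipschitz
bound on the truth extend this from the breakpoints to [0, b] at the cost of L c times the mesh.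
This proves (a). For (b), both adjusted utilities take values in [0, c], so the error is at most c ≤
c√N. -/

lemma omegaConst_pos (c : ℝ) : 0 < omegaConst c := by
  unfold omegaConst; positivity

lemma hasDerivAt_softplus (x : ℝ) :
    HasDerivAt (fun x => Real.log (1 + Real.exp x)) (Real.sigmoid x) x := by
  have h := ((Real.hasDerivAt_exp x).const_add 1).log (by positivity)
  convert h using 1
  rw [Real.sigmoid_def, Real.exp_neg]
  have := Real.exp_pos x
  field_simp
  ring

/-- The right side is the second derivative of softplus and equals 1 / (2 + exp x + exp (-x)); each
exponential is at most exp (2c). -/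
lemma omegaConst_le_sigmoid_mul {c x : ℝ} (hc : 0 < c) (hx : |x| ≤ c) :
    omegaConst c ≤ Real.sigmoid x * (1 - Real.sigmoid x) := by
  rw [← Real.sigmoid_neg, Real.sigmoid_def, Real.sigmoid_def, ← mul_inv, neg_neg, omegaConst,
    one_div]
  obtain ⟨h1, h2⟩ := abs_le.1 hx
  refine inv_anti₀ (by positivity) ?_
  have e1 : Real.exp x ≤ Real.exp (2 * c) := Real.exp_le_exp.2 (by linarith)
  have e2 : Real.exp (-x) ≤ Real.exp (2 * c) := Real.exp_le_exp.2 (by linarith)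
  have e3 : Real.exp (-x) * Real.exp x = 1 := by rw [← Real.exp_add]; simp
  nlinarith

/-- On `[-c, c]` the softplus function is strongly convex with modulus `omegaConst c`. -/
lemma softplus_tangent {c x a : ℝ} (hc : 0 < c) (hx : |x| ≤ c) (ha : |a| ≤ c) :
    Real.sigmoid a * (x - a) + omegaConst c / 2 * (x - a) ^ 2 ≤
      Real.log (1 + Real.exp x) - Real.log (1 + Real.exp a) := by
  set w := omegaConst c
  have hd : ∀ y, HasDerivAt (fun x => Real.log (1 + Real.exp x) - w / 2 * x ^ 2)
      (Real.sigmoid y - w * y) y := fun y => by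
    have h := (hasDerivAt_softplus y).sub ((hasDerivAt_pow 2 y).const_mul (w / 2))
    refine h.congr_deriv ?_
    norm_num
    ring
  have hd2 : ∀ y, HasDerivAt (fun y => Real.sigmoid y - w * y)
      (Real.sigmoid y * (1 - Real.sigmoid y) - w) y := fun y => by
    have h := (Real.hasDerivAt_sigmoid y).sub ((hasDerivAt_id y).const_mul w)
    refine h.congr_deriv ?_
    simp
  -- Removing the quadratic w/2 x² leaves a convex function; its tangent inequality at a,
  -- rearranged, is the claim.
  have hconv : ConvexOn ℝ (Set.Icc (-c) c)
      (fun x => Real.log (1 + Real.exp x) - w / 2 * x ^ 2) := by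
    refine convexOn_of_hasDerivWithinAt2_nonneg (convex_Icc _ _)
      (fun y _ => (hd y).continuousAt.continuousWithinAt)
      (fun y _ => (hd y).hasDerivWithinAt) (fun y _ => (hd2 y).hasDerivWithinAt) fun y hy => ?_
    have := omegaConst_le_sigmoid_mul hc (abs_le.2 (Set.mem_Icc.1 (interior_subset hy)))
    linarith
  have hx' : x ∈ Set.Icc (-c) c := abs_le.1 hx
  have ha' : a ∈ Set.Icc (-c) c := abs_le.1 ha
  rcases lt_trichotomy a x with h | h | h
  · have := hconv.le_slope_of_hasDerivAt ha' hx' h (hd a)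
    rw [slope_def_field, le_div_iff₀ (by linarith)] at this
    nlinarith
  · simp [h]
  · have := hconv.slope_le_of_hasDerivAt hx' ha' h (hd a)
    rw [slope_def_field, div_le_iff₀ (by linarith)] at this
    nlinarith

/-! ### Quadratic forms of sub-Gaussian vectors -/

lemma lintegral_exp_neg_mul_sq {b : ℝ} (hb : 0 < b) :
    ∫⁻ g : ℝ, ENNReal.ofReal (Real.exp (-b * g ^ 2)) = ENNReal.ofReal √(Real.pi / b) := by
  rw [← integral_gaussian, ofReal_integral_eq_lintegral_ofReal (integrable_exp_neg_mul_sq hb)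
    (ae_of_all _ fun _ => (Real.exp_pos _).le)]

/-- Completing the square. Read from right to left, this linearizes exp (a²) into exponentials
linear in a, which a sub-Gaussian bound controls. -/
lemma lintegral_exp_linear_sub_sq (a : ℝ) :
    ∫⁻ g : ℝ, ENNReal.ofReal (Real.exp (2 * g * a - g ^ 2)) =
      ENNReal.ofReal √Real.pi * ENNReal.ofReal (Real.exp (a ^ 2)) := by
  have h : ∀ g : ℝ, ENNReal.ofReal (Real.exp (2 * g * a - g ^ 2)) =
      ENNReal.ofReal (Real.exp (-1 * (g - a) ^ 2)) * ENNReal.ofReal (Real.exp (a ^ 2)) := by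
    intro g
    rw [← ENNReal.ofReal_mul (Real.exp_pos _).le, ← Real.exp_add]
    ring_nf
  simp_rw [h]
  rw [lintegral_mul_const _ (by fun_prop),
    lintegral_sub_right_eq_self (fun g : ℝ => ENNReal.ofReal (Real.exp (-1 * g ^ 2))) a,
    lintegral_exp_neg_mul_sq one_pos, div_one]

section Quadratic

variable {Ω E ι : Type*} [MeasurableSpace Ω] [NormedAddCommGroup E] [InnerProductSpace ℝ E]

/-- Exponential moment of the squared length of the projection of a sub-Gaussian vector. -/
lemma lintegral_exp_sum_sq_le {P : Measure Ω} [SFinite P] {V : Ω → E}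
    (hm : ∀ α : E, Measurable fun w => inner ℝ α (V w))
    (hV : ∀ α : E, ∫⁻ w, ENNReal.ofReal (Real.exp (inner ℝ α (V w))) ∂P ≤
      ENNReal.ofReal (Real.exp (‖α‖ ^ 2 / 8)))
    {e : ι → E} (he : Orthonormal ℝ e) (s : Finset ι) :
    ∀ β : E, (∀ i ∈ s, inner ℝ β (e i) = 0) →
      ∫⁻ w, ENNReal.ofReal (Real.exp (inner ℝ β (V w) + ∑ i ∈ s, inner ℝ (e i) (V w) ^ 2)) ∂P ≤
        ENNReal.ofReal √2 ^ s.card * ENNReal.ofReal (Real.exp (‖β‖ ^ 2 / 8)) := by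
  classical
  -- The bound is proved for all β because linearizing one square by an auxiliary Gaussian variable
  -- g shifts β by 2g e_i. Orthogonality of the e_j keeps the shifted vector admissible.
  induction s using Finset.induction_on with
  | empty => intro β _; simpa using hV β
  | insert i s hi ih =>
    intro β hβ
    have hβi : inner ℝ β (e i) = 0 := hβ i (by simp)
    set c : ℝ≥0∞ := ENNReal.ofReal √Real.pi with hc
    have hc0 : c ≠ 0 := by simp [hc, Real.pi_pos]
    have hct : c ≠ ∞ := by simp [hc]
    have key : c * ∫⁻ w, ENNReal.ofReal
          (Real.exp (inner ℝ β (V w) + ∑ j ∈ insert i s, inner ℝ (e j) (V w) ^ 2)) ∂P ≤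
        c * (ENNReal.ofReal √2 ^ (insert i s).card *
          ENNReal.ofReal (Real.exp (‖β‖ ^ 2 / 8))) := by
      calc c * ∫⁻ w, ENNReal.ofReal
            (Real.exp (inner ℝ β (V w) + ∑ j ∈ insert i s, inner ℝ (e j) (V w) ^ 2)) ∂P
          = ∫⁻ w, (∫⁻ g : ℝ, ENNReal.ofReal (Real.exp (inner ℝ (β + (2 * g) • e i) (V w) +
              ∑ j ∈ s, inner ℝ (e j) (V w) ^ 2)) * ENNReal.ofReal (Real.exp (-g ^ 2))) ∂P := by
            rw [← lintegral_const_mul']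
            swap
            · exact hct
            refine lintegral_congr fun w => ?_
            rw [Finset.sum_insert hi]
            have h1 : ∀ g : ℝ, ENNReal.ofReal (Real.exp (inner ℝ (β + (2 * g) • e i) (V w) +
                ∑ j ∈ s, inner ℝ (e j) (V w) ^ 2)) * ENNReal.ofReal (Real.exp (-g ^ 2)) =
                ENNReal.ofReal (Real.exp (inner ℝ β (V w) + ∑ j ∈ s, inner ℝ (e j) (V w) ^ 2)) *
                ENNReal.ofReal (Real.exp (2 * g * inner ℝ (e i) (V w) - g ^ 2)) := by
              intro g
              rw [← ENNReal.ofReal_mul (Real.exp_pos _).le, ← Real.exp_add,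
                ← ENNReal.ofReal_mul (Real.exp_pos _).le, ← Real.exp_add, inner_add_left,
                real_inner_smul_left]
              ring_nf
            simp_rw [h1]
            rw [lintegral_const_mul _ (by fun_prop), lintegral_exp_linear_sub_sq, ← hc,
              mul_left_comm, ← ENNReal.ofReal_mul (Real.exp_pos _).le, ← Real.exp_add]
            ring_nf
        _ = ∫⁻ g : ℝ, ∫⁻ w, ENNReal.ofReal (Real.exp (inner ℝ (β + (2 * g) • e i) (V w) +
              ∑ j ∈ s, inner ℝ (e j) (V w) ^ 2)) * ENNReal.ofReal (Real.exp (-g ^ 2)) ∂P := by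
            refine lintegral_lintegral_swap (Measurable.aemeasurable ?_)
            simp only [Function.uncurry_def, inner_add_left, real_inner_smul_left]
            have h2 : ∀ α : E, Measurable fun p : Ω × ℝ => inner ℝ α (V p.1) :=
              fun α => (hm α).comp measurable_fst
            have h3 : Measurable fun p : Ω × ℝ => ∑ j ∈ s, inner ℝ (e j) (V p.1) ^ 2 :=
              Finset.measurable_sum _ fun j _ => (h2 (e j)).pow_const 2
            have h4 := h2 β
            have h5 := h2 (e i)
            fun_prop
        -- As β ⟂ e_i, the shift adds 4g² to ‖β‖², hence g²/2 to the exponent. The weight exp (-g²)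
        -- becomes exp (-g²/2), whose integral √(2π) exceeds c = √π by the factor √2.
        _ ≤ ∫⁻ g : ℝ, (ENNReal.ofReal √2 ^ s.card * ENNReal.ofReal (Real.exp (‖β‖ ^ 2 / 8))) *
              ENNReal.ofReal (Real.exp (-(1 / 2) * g ^ 2)) := by
            refine lintegral_mono fun g => ?_
            rw [lintegral_mul_const' _ _ ENNReal.ofReal_ne_top]
            refine (mul_le_mul_left (ih (β + (2 * g) • e i) fun j hj => ?_) _).trans_eq ?_
            · have hij : i ≠ j := fun h => hi (h ▸ hj)
              rw [inner_add_left, real_inner_smul_left, he.2 hij, hβ j (by simp [hj])]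
              simp
            · have hn : ‖β + (2 * g) • e i‖ ^ 2 = ‖β‖ ^ 2 + 4 * g ^ 2 := by
                rw [@norm_add_sq_real, real_inner_smul_right, hβi, norm_smul, he.1 i,
                  Real.norm_eq_abs, mul_one, sq_abs]
                ring
              rw [hn, mul_assoc, mul_assoc, ← ENNReal.ofReal_mul (Real.exp_pos _).le,
                ← ENNReal.ofReal_mul (Real.exp_pos _).le, ← Real.exp_add, ← Real.exp_add]
              ring_nf
        _ = c * (ENNReal.ofReal √2 ^ (insert i s).card *
              ENNReal.ofReal (Real.exp (‖β‖ ^ 2 / 8))) := by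
            rw [lintegral_const_mul _ (by fun_prop), lintegral_exp_neg_mul_sq (by norm_num),
              Finset.card_insert_of_notMem hi, pow_succ, div_div_eq_mul_div, div_one,
              Real.sqrt_mul Real.pi_pos.le, ENNReal.ofReal_mul (Real.sqrt_nonneg _), ← hc]
            ring
    exact (ENNReal.mul_le_mul_iff_right hc0 hct).1 key

/-- Tail bound for the squared length of the projection of a sub-Gaussian vector. -/
lemma le_prob_sum_sq_le {P : Measure Ω} [IsProbabilityMeasure P] {V : Ω → E}
    (hm : ∀ α : E, Measurable fun w => inner ℝ α (V w))
    (hV : ∀ α : E, ∫⁻ w, ENNReal.ofReal (Real.exp (inner ℝ α (V w))) ∂P ≤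
      ENNReal.ofReal (Real.exp (‖α‖ ^ 2 / 8)))
    [Fintype ι] {e : ι → E} (he : Orthonormal ℝ e) {δ : ℝ} (hδ : 0 < δ) :
    ENNReal.ofReal (1 - δ) ≤
      P {w | ∑ i, inner ℝ (e i) (V w) ^ 2 ≤ Fintype.card ι - Real.log δ} := by
  set Q : Ω → ℝ := fun w => ∑ i, inner ℝ (e i) (V w) ^ 2 with hQ
  -- With √2 ≤ e the exponential moment is at most exp (card ι) = exp x * δ, so Markov's inequality
  -- at level exp x leaves probability δ.
  set x : ℝ := Fintype.card ι - Real.log δ with hx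
  have hQm : Measurable Q := Finset.measurable_sum _ fun j _ => (hm (e j)).pow_const 2
  have hmom : ∫⁻ w, ENNReal.ofReal (Real.exp (Q w)) ∂P ≤
      ENNReal.ofReal (Real.exp (Fintype.card ι)) := by
    have h := lintegral_exp_sum_sq_le hm hV he Finset.univ 0 (by simp)
    simp only [inner_zero_left, zero_add, norm_zero, Finset.card_univ] at h
    refine h.trans ?_
    rw [← ENNReal.ofReal_pow (Real.sqrt_nonneg _)]
    simp only [ne_eq, OfNat.ofNat_ne_zero, not_false_eq_true, zero_pow, zero_div, Real.exp_zero,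
      ENNReal.ofReal_one, mul_one]
    refine ENNReal.ofReal_le_ofReal ?_
    rw [← mul_one (Fintype.card ι : ℝ), Real.exp_nat_mul]
    refine pow_le_pow_left₀ (Real.sqrt_nonneg _) ?_ _
    rw [Real.sqrt_le_left (Real.exp_pos _).le]
    nlinarith [Real.add_one_le_exp (1 : ℝ)]
  have hbad : P {w | Q w ≤ x}ᶜ ≤ ENNReal.ofReal δ := by
    have hmk := mul_meas_ge_le_lintegral (μ := P)
      (f := fun w => ENNReal.ofReal (Real.exp (Q w))) (by fun_prop) (ENNReal.ofReal (Real.exp x))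
    have hsub : {w | Q w ≤ x}ᶜ ⊆
        {w | ENNReal.ofReal (Real.exp x) ≤ ENNReal.ofReal (Real.exp (Q w))} := by
      intro w hw
      simp only [Set.mem_compl_iff, Set.mem_ofPred_eq, not_le] at hw
      exact ENNReal.ofReal_le_ofReal (Real.exp_le_exp.2 hw.le)
    have h1 := ((mul_le_mul_right (measure_mono hsub) _).trans hmk).trans hmom
    have hxe : Real.exp (Fintype.card ι) = Real.exp x * δ := by
      rw [hx, Real.exp_sub, Real.exp_log hδ]
      field_simp
    rw [hxe, ENNReal.ofReal_mul (Real.exp_pos _).le] at h1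
    exact (ENNReal.mul_le_mul_iff_right (by simp [Real.exp_pos]) ENNReal.ofReal_ne_top).1 h1
  have hset : MeasurableSet {w | Q w ≤ x} := measurableSet_le hQm measurable_const
  have hcompl := prob_compl_eq_one_sub (μ := P) hset.compl
  rw [compl_compl] at hcompl
  rw [hcompl, ENNReal.ofReal_sub _ hδ.le, ENNReal.ofReal_one]
  exact tsub_le_tsub_left hbad 1

end Quadratic

/-! ### The Gumbel distribution -/

lemma integrableOn_Iic_deriv_of_nonneg {g g' : ℝ → ℝ} {a l : ℝ}
    (hderiv : ∀ x, HasDerivAt g (g' x) x) (hpos : ∀ x, 0 ≤ g' x) (hg : Tendsto g atBot (𝓝 l)) :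
    IntegrableOn g' (Set.Iic a) := by
  have h : IntegrableOn (fun x => g' (-x)) (Set.Ioi (-a)) := by
    refine integrableOn_Ioi_deriv_of_nonneg' (g := fun x => -g (-x)) (l := -l)
      (fun x _ => ?_) (fun x _ => hpos _) (hg.comp tendsto_neg_atTop_atBot).neg
    have := ((hderiv (-x)).comp x (hasDerivAt_neg x)).neg
    refine this.congr_deriv ?_
    ring
  rw [integrableOn_Iic_iff_integrableOn_Iio,
    ← (Measure.measurePreserving_neg (volume : Measure ℝ)).integrableOn_comp_preimage
      (Homeomorph.neg ℝ).measurableEmbedding]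
  simpa [Function.comp_def] using h

/-- Unnormalized Gumbel density, the derivative of `exp (-a * exp (-x / s)) / a`. -/
noncomputable def gumbelKernel (s a x : ℝ) : ℝ :=
  1 / s * Real.exp (-x / s) * Real.exp (-(a * Real.exp (-x / s)))

section Kernel

variable {s a : ℝ}

lemma gumbelKernel_nonneg (hs : 0 < s) (x : ℝ) : 0 ≤ gumbelKernel s a x := by
  unfold gumbelKernel; positivity

lemma hasDerivAt_gumbel (ha : 0 < a) (x : ℝ) :
    HasDerivAt (fun x => Real.exp (-(a * Real.exp (-x / s))) / a) (gumbelKernel s a x) x := by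
  have h1 : HasDerivAt (fun x : ℝ => -x / s) (-1 / s) x := (hasDerivAt_neg x).div_const s
  have h2 : HasDerivAt (fun x : ℝ => -(a * Real.exp (-x / s)))
      (-(a * (Real.exp (-x / s) * (-1 / s)))) x := (h1.exp.const_mul a).neg
  refine (h2.exp.div_const a).congr_deriv ?_
  simp only [gumbelKernel]
  field_simp

lemma tendsto_gumbel_atBot (hs : 0 < s) (ha : 0 < a) :
    Tendsto (fun x => Real.exp (-(a * Real.exp (-x / s))) / a) atBot (𝓝 0) := by
  have h1 : Tendsto (fun x : ℝ => Real.exp (-x / s)) atBot atTop :=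
    Real.tendsto_exp_atTop.comp (tendsto_neg_atBot_atTop.atTop_div_const hs)
  have h2 := (Real.tendsto_exp_atBot.comp
    (tendsto_neg_atTop_atBot.comp (h1.const_mul_atTop ha))).div_const a
  simpa [Function.comp_def] using h2

lemma tendsto_gumbel_atTop (hs : 0 < s) :
    Tendsto (fun x => Real.exp (-(a * Real.exp (-x / s))) / a) atTop (𝓝 (1 / a)) := by
  have h1 : Tendsto (fun x : ℝ => Real.exp (-x / s)) atTop (𝓝 0) :=
    Real.tendsto_exp_atBot.comp (tendsto_neg_atTop_atBot.atBot_div_const hs)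
  have h2 := ((Real.continuous_exp.tendsto _).comp (h1.const_mul a).neg).div_const a
  simpa [Function.comp_def] using h2

lemma lintegral_Iic_gumbelKernel (hs : 0 < s) (ha : 0 < a) (x : ℝ) :
    ∫⁻ y in Set.Iic x, ENNReal.ofReal (gumbelKernel s a y) =
      ENNReal.ofReal (Real.exp (-(a * Real.exp (-x / s))) / a) := by
  have hi := integrableOn_Iic_deriv_of_nonneg (a := x) (fun x => hasDerivAt_gumbel (s := s) ha x)
    (gumbelKernel_nonneg hs) (tendsto_gumbel_atBot hs ha)
  rw [← ofReal_integral_eq_lintegral_ofReal hi (ae_of_all _ (gumbelKernel_nonneg hs)),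
    integral_Iic_of_hasDerivAt_of_tendsto' (fun x _ => hasDerivAt_gumbel (s := s) ha x) hi
      (tendsto_gumbel_atBot hs ha), sub_zero]

lemma lintegral_gumbelKernel (hs : 0 < s) (ha : 0 < a) :
    ∫⁻ y, ENNReal.ofReal (gumbelKernel s a y) = ENNReal.ofReal (1 / a) := by
  have hi : Integrable (gumbelKernel s a) := by
    rw [← integrableOn_univ, ← Set.Iic_union_Ioi (a := (0 : ℝ))]
    exact (integrableOn_Iic_deriv_of_nonneg (fun x => hasDerivAt_gumbel (s := s) ha x)
      (gumbelKernel_nonneg hs) (tendsto_gumbel_atBot hs ha)).union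
      (integrableOn_Ioi_deriv_of_nonneg' (fun x _ => hasDerivAt_gumbel (s := s) ha x)
        (fun x _ => gumbelKernel_nonneg hs x) (tendsto_gumbel_atTop hs))
  rw [← ofReal_integral_eq_lintegral_ofReal hi (ae_of_all _ (gumbelKernel_nonneg hs)),
    integral_of_hasDerivAt_of_tendsto (fun x => hasDerivAt_gumbel (s := s) ha x) hi
      (tendsto_gumbel_atBot hs ha) (tendsto_gumbel_atTop hs), sub_zero]

end Kernel

lemma gumbelMeasure_eq (s : ℝ) :
    gumbelMeasure s = volume.withDensity fun x => ENNReal.ofReal (gumbelKernel s 1 x) := by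
  simp only [gumbelMeasure, gumbelKernel, one_mul]

lemma measurable_gumbelKernel (s a : ℝ) : Measurable (gumbelKernel s a) := by
  unfold gumbelKernel; fun_prop

lemma gumbelMeasure_Iic {s : ℝ} (hs : 0 < s) (x : ℝ) :
    gumbelMeasure s (Set.Iic x) = ENNReal.ofReal (Real.exp (-Real.exp (-x / s))) := by
  rw [gumbelMeasure_eq, withDensity_apply _ measurableSet_Iic,
    lintegral_Iic_gumbelKernel hs one_pos]
  simp

/-- The difference of two independent Gumbel variables has the logistic distribution. -/
lemma gumbelMeasure_prod_le {s : ℝ} (hs : 0 < s) [SFinite (gumbelMeasure s)] (m : ℝ) :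
    ((gumbelMeasure s).prod (gumbelMeasure s)) {p | p.2 ≤ p.1 + m} =
      ENNReal.ofReal (Real.sigmoid (m / s)) := by
  have hset : MeasurableSet {p : ℝ × ℝ | p.2 ≤ p.1 + m} :=
    measurableSet_le (by fun_prop) (by fun_prop)
  rw [Measure.prod_apply hset]
  have h1 : ∀ x : ℝ, Prod.mk x ⁻¹' {p : ℝ × ℝ | p.2 ≤ p.1 + m} = Set.Iic (x + m) := fun x => rfl
  simp_rw [h1, gumbelMeasure_Iic hs]
  rw [gumbelMeasure_eq, lintegral_withDensity_eq_lintegral_mul _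
    (measurable_gumbelKernel s 1).ennreal_ofReal (by fun_prop)]
  -- Density at x times distribution function at x + m is again a kernel, with a = 1 + exp (-m/s);
  -- its total mass 1/a is the sigmoid of m/s.
  have h2 : ∀ x : ℝ, ((fun x => ENNReal.ofReal (gumbelKernel s 1 x)) * fun x =>
      ENNReal.ofReal (Real.exp (-Real.exp (-(x + m) / s)))) x =
      ENNReal.ofReal (gumbelKernel s (1 + Real.exp (-(m / s))) x) := by
    intro x
    rw [Pi.mul_apply, ← ENNReal.ofReal_mul (gumbelKernel_nonneg hs x)]
    congr 1
    have h3 : -(x + m) / s = -(m / s) + -x / s := by ring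
    simp only [gumbelKernel]
    rw [mul_assoc, ← Real.exp_add, h3, Real.exp_add (-(m / s))]
    ring_nf
  simp_rw [h2]
  rw [lintegral_gumbelKernel hs (by positivity), Real.sigmoid_def, one_div]

/-! ### Centered choices -/

section Choice

variable {b L c : ℝ} {D : Questionnaire b} {Ω : Type*} [MeasurableSpace Ω] {P : Measure Ω}

lemma sigmaStar_pos (hc : 0 < c) (M : DecisionMaker L c D P) : 0 < M.sigmaStar :=
  (one_div_pos.2 hc).trans_le M.le_sigmaStar

open Classical in
/-- The indicator that `W k` is chosen, as a function of the two errors, minus its expectation. -/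
noncomputable def DecisionMaker.residualFun (M : DecisionMaker L c D P) (k : Fin D.K)
    (p : ℝ × ℝ) : ℝ :=
  (if p.2 ≤ p.1 + ((D.W k).expect M.uStar - (D.Y k).expect M.uStar) then 1 else 0) -
    Real.sigmoid (((D.W k).expect M.uStar - (D.Y k).expect M.uStar) / M.sigmaStar)

/-- The indicator that `W k` is chosen, minus its probability. -/
noncomputable def DecisionMaker.residual (M : DecisionMaker L c D P) (k : Fin D.K) (w : Ω) : ℝ :=
  M.residualFun k (M.eps (k, 0) w, M.eps (k, 1) w)

lemma measurable_residualFun (M : DecisionMaker L c D P) (k : Fin D.K) :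
    Measurable (M.residualFun k) := by
  unfold DecisionMaker.residualFun
  exact (Measurable.ite (measurableSet_le (by fun_prop) (by fun_prop)) measurable_const
    measurable_const).sub_const _

lemma measurable_residual (M : DecisionMaker L c D P) (k : Fin D.K) :
    Measurable (M.residual k) :=
  (measurable_residualFun M k).comp ((M.measurable_eps _).prodMk (M.measurable_eps _))

lemma choice_eq (M : DecisionMaker L c D P) (k : Fin D.K) (w : Ω) :
    M.choice k w = 2 * (M.residual k w + Real.sigmoid
      (((D.W k).expect M.uStar - (D.Y k).expect M.uStar) / M.sigmaStar)) - 1 := by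
  unfold DecisionMaker.choice DecisionMaker.residual DecisionMaker.residualFun
  simp only [sub_add_cancel]
  split_ifs with h1 h2 h2
  · norm_num
  · exact absurd (by linarith) h2
  · exact absurd (by linarith) h1
  · norm_num

lemma choice_eq_or (M : DecisionMaker L c D P) (k : Fin D.K) (w : Ω) :
    M.choice k w = 1 ∨ M.choice k w = -1 := by
  unfold DecisionMaker.choice; split_ifs <;> simp

/-- The logistic law of the error difference makes the probability of choosing W k exactly the
sigmoid term being subtracted. -/
lemma integral_residual [IsProbabilityMeasure P] (hc : 0 < c) (M : DecisionMaker L c D P)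
    (k : Fin D.K) :
    ∫ w, M.residual k w ∂P = 0 := by
  classical
  have hs := sigmaStar_pos hc M
  set m := (D.W k).expect M.uStar - (D.Y k).expect M.uStar with hm
  have hg : IsProbabilityMeasure (gumbelMeasure M.sigmaStar) := by
    rw [← M.law_eps (k, 0)]
    exact Measure.isProbabilityMeasure_map (M.measurable_eps _).aemeasurable
  have hind : IndepFun (M.eps (k, 0)) (M.eps (k, 1)) P := M.indep_eps.indepFun (by simp)
  have hlaw := (indepFun_iff_map_prod_eq_prod_map_map (M.measurable_eps _).aemeasurable
    (M.measurable_eps _).aemeasurable).1 hind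
  rw [M.law_eps, M.law_eps] at hlaw
  have hset : MeasurableSet {p : ℝ × ℝ | p.2 ≤ p.1 + m} :=
    measurableSet_le (by fun_prop) (by fun_prop)
  have hint : ∫ p, M.residualFun k p
      ∂((gumbelMeasure M.sigmaStar).prod (gumbelMeasure M.sigmaStar)) = 0 := by
    have h1 : M.residualFun k = fun p => Set.indicator {p : ℝ × ℝ | p.2 ≤ p.1 + m}
        (fun _ => (1 : ℝ)) p - Real.sigmoid (m / M.sigmaStar) := by
      funext p
      simp only [DecisionMaker.residualFun, Set.indicator_apply, Set.mem_ofPred_eq, ← hm]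
    rw [h1, integral_sub ((integrable_const _).indicator hset) (integrable_const _),
      integral_indicator_const _ hset, Measure.real, gumbelMeasure_prod_le hs,
      ENNReal.toReal_ofReal (Real.sigmoid_nonneg _)]
    simp
  rw [← hlaw, integral_map ((M.measurable_eps _).prodMk (M.measurable_eps _)).aemeasurable
    (measurable_residualFun M k).aestronglyMeasurable] at hint
  exact hint

/-- Hoeffding's lemma: the values lie in an interval of length 1, so the variance proxy is (1/2)².
-/
lemma hasSubgaussianMGF_residual [IsProbabilityMeasure P] (hc : 0 < c)
    (M : DecisionMaker L c D P) (k : Fin D.K) :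
    HasSubgaussianMGF (M.residual k) (1 / 4) P := by
  set q := Real.sigmoid (((D.W k).expect M.uStar - (D.Y k).expect M.uStar) / M.sigmaStar) with hq
  have h := hasSubgaussianMGF_of_mem_Icc_of_integral_eq_zero (a := -q) (b := 1 - q)
    (measurable_residual M k).aemeasurable (ae_of_all P fun w => ?_) (integral_residual hc M k)
  · convert h using 1
    rw [sub_neg_eq_add, sub_add_cancel, nnnorm_one, div_pow]
    norm_num
  · simp only [DecisionMaker.residual, DecisionMaker.residualFun, ← hq]
    split_ifs <;> constructor <;> norm_num

/-- Linear combinations of the residuals are sub-Gaussian. -/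
lemma hasSubgaussianMGF_sum_residual [IsProbabilityMeasure P] (hc : 0 < c)
    (M : DecisionMaker L c D P) (α : Fin D.K → ℝ) (s : Finset (Fin D.K)) :
    HasSubgaussianMGF (fun w => ∑ k ∈ s, α k * M.residual k w)
      (∑ k ∈ s, Real.toNNReal (α k ^ 2) * (1 / 4)) P := by
  classical
  induction s using Finset.induction_on with
  | empty => simp
  | insert i s hi ih =>
    -- Different queries use disjoint blocks of errors, so the partial sum over s is independent of
    -- the residual at i.
    have hdis : Disjoint (s ×ˢ (Finset.univ : Finset (Fin 2))) ({i} ×ˢ Finset.univ) := by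
      rw [Finset.disjoint_left]
      rintro ⟨x, y⟩ h1 h2
      simp only [Finset.mem_product, Finset.mem_singleton, Finset.mem_univ, and_true] at h1 h2
      exact hi (h2 ▸ h1)
    have hI := M.indep_eps.indepFun_finset _ _ hdis M.measurable_eps
    have hI2 := hI.comp
      (φ := fun x => ∑ k : s, α k * M.residualFun k
        (x ⟨(k.1, 0), by simp⟩, x ⟨(k.1, 1), by simp⟩))
      (ψ := fun x => α i * M.residualFun i (x ⟨(i, 0), by simp⟩, x ⟨(i, 1), by simp⟩))
      (Finset.measurable_sum _ fun k _ => ((measurable_residualFun M k).comp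
        ((measurable_pi_apply _).prodMk (measurable_pi_apply _))).const_mul _)
      (((measurable_residualFun M i).comp
        ((measurable_pi_apply _).prodMk (measurable_pi_apply _))).const_mul _)
    have h1 : HasSubgaussianMGF (fun w => α i * M.residual i w)
        (Real.toNNReal (α i ^ 2) * (1 / 4)) P := by
      convert (hasSubgaussianMGF_residual hc M i).const_mul (α i) using 2
      exact congrArg (· * (1 / 4)) (Real.toNNReal_of_nonneg (sq_nonneg (α i)))
    rw [Finset.sum_insert hi]
    simp_rw [Finset.sum_insert hi]
    refine HasSubgaussianMGF.add_of_indepFun h1 ih ?_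
    convert hI2.symm using 1
    · rfl
    funext w
    exact (Finset.sum_coe_sort s fun k => α k * M.residual k w).symm

/-- The residuals as a random vector. -/
noncomputable def DecisionMaker.residualVec (M : DecisionMaker L c D P) (w : Ω) :
    EuclideanSpace ℝ (Fin D.K) :=
  WithLp.toLp 2 fun k => M.residual k w

lemma inner_residualVec (M : DecisionMaker L c D P) (α : EuclideanSpace ℝ (Fin D.K)) (w : Ω) :
    inner ℝ α (M.residualVec w) = ∑ k, α k * M.residual k w := by
  simp [DecisionMaker.residualVec, PiLp.inner_apply, mul_comm]

lemma measurable_inner_residualVec (M : DecisionMaker L c D P) (α : EuclideanSpace ℝ (Fin D.K)) :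
    Measurable fun w => inner ℝ α (M.residualVec w) := by
  simp_rw [inner_residualVec]
  exact Finset.measurable_sum _ fun k _ => (measurable_residual M k).const_mul _

lemma lintegral_exp_inner_residualVec_le [IsProbabilityMeasure P] (hc : 0 < c)
    (M : DecisionMaker L c D P) (α : EuclideanSpace ℝ (Fin D.K)) :
    ∫⁻ w, ENNReal.ofReal (Real.exp (inner ℝ α (M.residualVec w))) ∂P ≤
      ENNReal.ofReal (Real.exp (‖α‖ ^ 2 / 8)) := by
  simp_rw [inner_residualVec]
  have h := hasSubgaussianMGF_sum_residual hc M α Finset.univ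
  have hi := h.integrable_exp_mul 1
  have hle := h.mgf_le 1
  simp only [one_mul, mgf] at hi hle
  rw [← ofReal_integral_eq_lintegral_ofReal hi (ae_of_all _ fun _ => (Real.exp_pos _).le)]
  refine ENNReal.ofReal_le_ofReal (hle.trans_eq ?_)
  congr 1
  rw [EuclideanSpace.real_norm_sq_eq]
  push_cast
  rw [← Finset.sum_mul]
  simp_rw [Real.coe_toNNReal _ (sq_nonneg _)]
  ring

end Choice

/-! ### The smallest eigenvalue -/

/-- The infimum of the Rayleigh quotient is itself an eigenvalue, so it dominates `lambdaMin A`.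
Semidefiniteness bounds the eigenvalues below, as `csInf_le` requires. -/
lemma lambdaMin_mul_le {m : ℕ} {A : Matrix (Fin m) (Fin m) ℝ} (hA : A.PosSemidef)
    (x : EuclideanSpace ℝ (Fin m)) :
    lambdaMin A * ‖x‖ ^ 2 ≤ inner ℝ (Matrix.toEuclideanLin A x) x := by
  rcases eq_or_ne x 0 with rfl | hx
  · simp
  have : Nontrivial (EuclideanSpace ℝ (Fin m)) := ⟨x, 0, hx⟩
  have hpos : ∀ v : EuclideanSpace ℝ (Fin m), 0 ≤ inner ℝ (Matrix.toEuclideanLin A v) v := by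
    intro v
    have h := hA.dotProduct_mulVec_nonneg (WithLp.ofLp v)
    simpa [EuclideanSpace.inner_eq_star_dotProduct, Matrix.toLpLin_apply] using h
  have hsymm : (Matrix.toEuclideanLin A).IsSymmetric :=
    Matrix.isSymmetric_toEuclideanLin_iff.2 hA.isHermitian
  have hev := hsymm.hasEigenvalue_iInf_of_finiteDimensional
  set μ := ⨅ y : { y : EuclideanSpace ℝ (Fin m) // y ≠ 0 },
    RCLike.re (inner ℝ (Matrix.toEuclideanLin A y) y) / ‖(y : EuclideanSpace ℝ (Fin m))‖ ^ 2
  have hmem : Module.End.HasEigenvalue (Matrix.toLin' A) μ := by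
    obtain ⟨v, hv⟩ := hev.exists_hasEigenvector
    refine Module.End.hasEigenvalue_of_hasEigenvector (x := WithLp.ofLp v)
      ⟨Module.End.mem_eigenspace_iff.2 ?_, fun h => hv.2 ?_⟩
    · have := congrArg WithLp.ofLp hv.apply_eq_smul
      simpa [Matrix.toLpLin_apply] using this
    · ext i; simpa using congrFun h i
  have hbdd : BddBelow {x : ℝ | Module.End.HasEigenvalue (Matrix.toLin' A) x} := by
    refine ⟨0, fun z hz => ?_⟩
    obtain ⟨v, hv⟩ := hz.exists_hasEigenvector
    have h1 := hA.dotProduct_mulVec_nonneg v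
    have h2 : A *ᵥ v = z • v := by simpa using hv.apply_eq_smul
    have h3 : 0 < v ⬝ᵥ v := by
      have := Matrix.dotProduct_star_self_pos_iff.2 hv.2
      simpa using this
    rw [h2, star_trivial, dotProduct_smul, smul_eq_mul] at h1
    exact nonneg_of_mul_nonneg_left h1 h3
  have h1 : lambdaMin A ≤ μ := csInf_le hbdd hmem
  have h2 : μ ≤ inner ℝ (Matrix.toEuclideanLin A x) x / ‖x‖ ^ 2 := by
    refine ciInf_le (f := fun y : { y : EuclideanSpace ℝ (Fin m) // y ≠ 0 } =>
      RCLike.re (inner ℝ (Matrix.toEuclideanLin A y) y) /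
        ‖(y : EuclideanSpace ℝ (Fin m))‖ ^ 2) ⟨0, ?_⟩ ⟨x, hx⟩
    rintro _ ⟨y, rfl⟩
    exact div_nonneg (hpos y) (sq_nonneg _)
  rw [← le_div_iff₀ (by positivity)]
  exact h1.trans h2

/-- The smallest eigenvalue of the information matrix controls the mass-difference map. -/
lemma lambdaMin_infoMatrix_mul_le {b : ℝ} (D : Questionnaire b)
    (x : EuclideanSpace ℝ (Fin (D.N - 1))) :
    lambdaMin D.infoMatrix * D.K * ‖x‖ ^ 2 ≤ ‖Matrix.toEuclideanLin D.reducedMatrix x‖ ^ 2 := by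
  have hK : (0 : ℝ) < D.K := by exact_mod_cast D.K_pos
  have hps : D.infoMatrix.PosSemidef := by
    have := Matrix.posSemidef_conjTranspose_mul_self D.reducedMatrix
    rw [Matrix.conjTranspose_eq_transpose_of_trivial] at this
    exact this.smul (by positivity)
  have h := lambdaMin_mul_le hps x
  have h2 : inner ℝ (Matrix.toEuclideanLin D.infoMatrix x) x =
      1 / D.K * ‖Matrix.toEuclideanLin D.reducedMatrix x‖ ^ 2 := by
    rw [← real_inner_self_eq_norm_sq, Questionnaire.infoMatrix, map_smul, LinearMap.smul_apply,
      real_inner_smul_left]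
    congr 1
    simp only [EuclideanSpace.inner_eq_star_dotProduct, Matrix.toLpLin_apply, star_trivial]
    rw [← Matrix.mulVec_mulVec, Matrix.mulVec_transpose, dotProduct_comm,
      ← Matrix.dotProduct_mulVec]
  rw [h2, one_div, inv_mul_eq_div, le_div_iff₀ hK] at h
  linarith

/-! ### Breakpoints -/

namespace Questionnaire

variable {b : ℝ} (D : Questionnaire b)

lemma zero_mem_supportSet : (0 : ℝ) ∈ D.supportSet := by simp [supportSet]

lemma right_mem_supportSet : b ∈ D.supportSet := by simp [supportSet]

lemma support_W_subset (k : Fin D.K) : (D.W k).prob.support ⊆ D.supportSet := by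
  intro y hy
  simp only [supportSet, Finset.mem_union, Finset.mem_biUnion]
  exact Or.inl (Or.inl (Or.inr ⟨k, Finset.mem_univ _, hy⟩))

lemma support_Y_subset (k : Fin D.K) : (D.Y k).prob.support ⊆ D.supportSet := by
  intro y hy
  simp only [supportSet, Finset.mem_union, Finset.mem_biUnion]
  exact Or.inl (Or.inr ⟨k, Finset.mem_univ _, hy⟩)

lemma supportSet_subset (hb : 0 < b) {y : ℝ} (hy : y ∈ D.supportSet) : y ∈ Set.Icc 0 b := by
  simp only [supportSet, Finset.mem_union, Finset.mem_biUnion, Finset.mem_singleton] at hy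
  rcases hy with ((rfl | ⟨k, -, h⟩) | ⟨k, -, h⟩) | rfl
  · exact ⟨le_rfl, hb.le⟩
  · exact (D.W k).support_subset y h
  · exact (D.Y k).support_subset y h
  · exact ⟨hb.le, le_rfl⟩

lemma breakpoint_mem (hb : 0 < b) (j : Fin D.N) : D.breakpoint j ∈ Set.Icc 0 b :=
  D.supportSet_subset hb (Finset.orderEmbOfFin_mem _ _ _)

lemma two_le_N (hb : 0 < b) : 2 ≤ D.N :=
  Finset.one_lt_card.2 ⟨0, D.zero_mem_supportSet, b, D.right_mem_supportSet, hb.ne⟩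

lemma breakpoint_zero (hb : 0 < b) (h : 0 < D.N) : D.breakpoint ⟨0, h⟩ = 0 := by
  refine (Finset.orderEmbOfFin_zero (s := D.supportSet) rfl h).trans ?_
  exact le_antisymm (Finset.min'_le _ _ D.zero_mem_supportSet)
    (Finset.le_min' _ _ _ fun y hy => (D.supportSet_subset hb hy).1)

lemma breakpoint_last (hb : 0 < b) (h : 0 < D.N) :
    D.breakpoint ⟨D.N - 1, Nat.sub_lt h one_pos⟩ = b := by
  refine (Finset.orderEmbOfFin_last (s := D.supportSet) rfl h).trans ?_
  exact le_antisymm (Finset.max'_le _ _ _ fun y hy => (D.supportSet_subset hb hy).2)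
    (Finset.le_max' _ _ D.right_mem_supportSet)

lemma gap_le_mesh (j : Fin (D.N - 1)) :
    D.breakpoint ⟨j.1 + 1, by omega⟩ - D.breakpoint ⟨j.1, by omega⟩ ≤ D.mesh :=
  le_ciSup (f := fun j : Fin (D.N - 1) =>
    D.breakpoint ⟨j.1 + 1, by omega⟩ - D.breakpoint ⟨j.1, by omega⟩)
    (Set.finite_range _).bddAbove j

/-- Every outcome lies between two consecutive breakpoints. -/
lemma exists_gap (hb : 0 < b) {y : ℝ} (hy : y ∈ Set.Icc 0 b) :
    ∃ j : Fin (D.N - 1), D.breakpoint ⟨j.1, by omega⟩ ≤ y ∧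
      y ≤ D.breakpoint ⟨j.1 + 1, by omega⟩ := by
  have hN := D.two_le_N hb
  -- Descend from a breakpoint above y until the preceding one is below y. The descent starts at n =
  -- N - 2, since index N - 1 carries b.
  have key : ∀ n (hn : n + 1 < D.N), y ≤ D.breakpoint ⟨n + 1, hn⟩ →
      ∃ j : Fin (D.N - 1), D.breakpoint ⟨j.1, by omega⟩ ≤ y ∧
        y ≤ D.breakpoint ⟨j.1 + 1, by omega⟩ := by
    intro n
    induction n with
    | zero =>
      intro hn h
      exact ⟨⟨0, by omega⟩, (D.breakpoint_zero hb (by omega)).trans_le hy.1, h⟩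
    | succ n ih =>
      intro hn h
      rcases le_total y (D.breakpoint ⟨n + 1, by omega⟩) with h1 | h1
      · exact ih _ h1
      · exact ⟨⟨n + 1, by omega⟩, h1, h⟩
  refine key (D.N - 2) (by omega) ?_
  have h := D.breakpoint_last hb (by omega)
  have h2 : (⟨D.N - 2 + 1, by omega⟩ : Fin D.N) = ⟨D.N - 1, by omega⟩ := by
    ext; simp only; omega
  rw [h2, h]
  exact hy.2

lemma sum_supportSet (f : ℝ → ℝ) : ∑ y ∈ D.supportSet, f y = ∑ j, f (D.breakpoint j) := by
  conv_lhs => rw [← Finset.map_orderEmbOfFin_univ D.supportSet rfl]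
  rw [Finset.sum_map]
  rfl

lemma sum_fin_eq_add {n : ℕ} (hn : 0 < n) (f : Fin n → ℝ) :
    ∑ j, f j = f ⟨0, hn⟩ + ∑ j : Fin (n - 1), f ⟨j.1 + 1, by omega⟩ := by
  obtain ⟨m, rfl⟩ : ∃ m, n = m + 1 := ⟨n - 1, by omega⟩
  exact Fin.sum_univ_succ f

/-- The values of a function at all breakpoints except the first one. -/
noncomputable def values (v : ℝ → ℝ) : EuclideanSpace ℝ (Fin (D.N - 1)) :=
  WithLp.toLp 2 fun j => v (D.breakpoint ⟨j.1 + 1, by omega⟩)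

/-- The first breakpoint is 0, so the normalization v 0 = 0 makes the dropped column irrelevant. -/
lemma expect_sub_expect (hb : 0 < b) {v : ℝ → ℝ} (hv : v 0 = 0) (k : Fin D.K) :
    (D.W k).expect v - (D.Y k).expect v =
      Matrix.toEuclideanLin D.reducedMatrix (D.values v) k := by
  have hN := D.two_le_N hb
  have hW : (D.W k).expect v = ∑ y ∈ D.supportSet, (D.W k).prob y * v y :=
    Finset.sum_subset (D.support_W_subset k) fun y _ hy => by
      rw [Finsupp.notMem_support_iff.1 hy, zero_mul]
  have hY : (D.Y k).expect v = ∑ y ∈ D.supportSet, (D.Y k).prob y * v y :=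
    Finset.sum_subset (D.support_Y_subset k) fun y _ hy => by
      rw [Finsupp.notMem_support_iff.1 hy, zero_mul]
  rw [hW, hY, ← Finset.sum_sub_distrib, sum_supportSet, sum_fin_eq_add (by omega),
    D.breakpoint_zero hb, hv]
  simp only [mul_zero, sub_zero, zero_add, ← sub_mul]
  rfl

/-- Two nondecreasing functions, one of them Lipschitz, that are close at the breakpoints are
close everywhere. -/
lemma kolmogorovDist_le (hb : 0 < b) {f g : ℝ → ℝ} {l r : ℝ} (hl : 0 ≤ l)
    (hf : MonotoneOn f (Set.Icc 0 b)) (hg : MonotoneOn g (Set.Icc 0 b))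
    (hgl : ∀ x ∈ Set.Icc 0 b, ∀ y ∈ Set.Icc 0 b, x ≤ y → g y - g x ≤ l * (y - x))
    (hr : ∀ j, |f (D.breakpoint j) - g (D.breakpoint j)| ≤ r) :
    kolmogorovDist b f g ≤ l * D.mesh + r := by
  have : Nonempty (Set.Icc (0 : ℝ) b) := ⟨⟨0, le_rfl, hb.le⟩⟩
  refine ciSup_le fun ⟨y, hy⟩ => ?_
  obtain ⟨j, h1, h2⟩ := D.exists_gap hb hy
  have m1 := D.breakpoint_mem hb ⟨j.1, by omega⟩
  have m2 := D.breakpoint_mem hb ⟨j.1 + 1, by omega⟩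
  have hgap := mul_le_mul_of_nonneg_left (D.gap_le_mesh j) hl
  have g1 := hgl _ m1 _ m2 (h1.trans h2)
  have r1 := abs_le.1 (hr ⟨j.1, by omega⟩)
  have r2 := abs_le.1 (hr ⟨j.1 + 1, by omega⟩)
  have f1 := hf m1 hy h1
  have f2 := hf hy m2 h2
  have g2 := hg m1 hy h1
  have g3 := hg hy m2 h2
  -- Monotonicity compares f y with f at an endpoint of the gap, closeness passes to g there, and g
  -- varies by at most l times the mesh across the gap.
  exact abs_le.2 ⟨by linarith [r1.1], by linarith [r2.2]⟩

end Questionnaire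

/-! ### Utilities and their expectations -/

section Utility

variable {b L c : ℝ} {u : ℝ → ℝ}

lemma IsUtility.mem_Icc (hb : 0 < b) (hu : IsUtility b L u) {y : ℝ} (hy : y ∈ Set.Icc 0 b) :
    u y ∈ Set.Icc 0 1 :=
  ⟨hu.map_zero ▸ hu.mono ⟨le_rfl, hb.le⟩ hy hy.1, hu.map_right ▸ hu.mono hy ⟨hb.le, le_rfl⟩ hy.2⟩

lemma IsUtility.sub_le (hL : 0 < L) (hu : IsUtility b L u) {x y : ℝ} (hx : x ∈ Set.Icc 0 b)
    (hy : y ∈ Set.Icc 0 b) (hxy : x ≤ y) : u y - u x ≤ L * (y - x) := by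
  have h := hu.lipschitz.dist_le_mul y hy x hx
  rw [Real.dist_eq, Real.dist_eq, abs_of_nonneg (sub_nonneg.2 hxy), Real.coe_toNNReal _ hL.le] at h
  exact (le_abs_self _).trans h

lemma Lottery.expect_mem_Icc (hb : 0 < b) (hu : IsUtility b L u) (X : Lottery b) :
    X.expect u ∈ Set.Icc 0 1 := by
  refine ⟨Finset.sum_nonneg fun y hy => mul_nonneg (X.prob_nonneg y)
    (hu.mem_Icc hb (X.support_subset y hy)).1, ?_⟩
  rw [← X.sum_prob]
  exact Finset.sum_le_sum fun y hy => mul_le_of_le_one_right (X.prob_nonneg y)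
    (hu.mem_Icc hb (X.support_subset y hy)).2

lemma Lottery.abs_expect_sub_le (hb : 0 < b) (hu : IsUtility b L u) (X Y : Lottery b) :
    |X.expect u - Y.expect u| ≤ 1 := by
  obtain ⟨h1, h2⟩ := X.expect_mem_Icc hb hu
  obtain ⟨h3, h4⟩ := Y.expect_mem_Icc hb hu
  exact abs_le.2 ⟨by linarith, by linarith⟩

lemma Lottery.expect_mul_sub_div (X : Lottery b) (p q : ℝ) (f g : ℝ → ℝ) :
    X.expect (fun y => p * f y - g y / q) = p * X.expect f - X.expect g / q := by
  simp only [Lottery.expect, Finset.mul_sum, Finset.sum_div, ← Finset.sum_sub_distrib]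
  exact Finset.sum_congr rfl fun y _ => by ring

lemma toReal_inv_le (hc : 0 < c) {s : ℝ≥0∞} (hs : ENNReal.ofReal (1 / c) ≤ s) :
    (s⁻¹).toReal ≤ c := by
  refine ENNReal.toReal_le_of_le_ofReal hc.le ?_
  have h := ENNReal.inv_le_inv.2 hs
  rwa [← ENNReal.ofReal_inv_of_pos (by positivity), one_div, inv_inv] at h

lemma one_div_sigmaStar_le {D : Questionnaire b} {Ω : Type*} [MeasurableSpace Ω] {P : Measure Ω}
    (hc : 0 < c) (M : DecisionMaker L c D P) : 1 / M.sigmaStar ≤ c :=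
  (one_div_le hc (sigmaStar_pos hc M)).1 M.le_sigmaStar

end Utility

/-! ### The basic inequality for maximum likelihood estimates -/

section MLE

variable {b L c : ℝ} {D : Questionnaire b} {Ω : Type*} [MeasurableSpace Ω] {P : Measure Ω}

/-- Exponential family form: the answer enters only linearly, and the convex part is the same for
both answers. -/
lemma neg_log_one_add_exp {z : ℝ} (hz : z = 1 ∨ z = -1) (x : ℝ) :
    -Real.log (1 + Real.exp (-z * x)) = (1 + z) / 2 * x - Real.log (1 + Real.exp x) := by
  rcases hz with rfl | rfl
  · have h : 1 + Real.exp x = Real.exp x * (1 + Real.exp (-1 * x)) := by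
      rw [mul_add, ← Real.exp_add]
      simp [add_comm]
    rw [h, Real.log_mul (Real.exp_pos _).ne' (by positivity), Real.log_exp]
    ring
  · norm_num

/-- The estimation error of the adjusted utility at the breakpoints. -/
noncomputable def DecisionMaker.errorVec (M : DecisionMaker L c D P) (u : ℝ → ℝ) (s : ℝ≥0∞) :
    EuclideanSpace ℝ (Fin (D.N - 1)) :=
  D.values fun y => adjusted u s y - M.uStar y / M.sigmaStar

/-- Since the estimate is at least as likely as the truth, strong convexity of the loss bounds the
prediction error by its correlation with the residuals. -/
lemma basic_inequality (hb : 0 < b) (hc : 0 < c) (M : DecisionMaker L c D P) {w : Ω}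
    {u : ℝ → ℝ} {s : ℝ≥0∞} (hmle : IsMLE L c D (fun k => M.choice k w) u s) :
    omegaConst c / 2 * ‖Matrix.toEuclideanLin D.reducedMatrix (M.errorVec u s)‖ ^ 2 ≤
      inner ℝ (M.residualVec w) (Matrix.toEuclideanLin D.reducedMatrix (M.errorVec u s)) := by
  have hσ := sigmaStar_pos hc M
  set a : Fin D.K → ℝ := fun k =>
    ((D.W k).expect M.uStar - (D.Y k).expect M.uStar) / M.sigmaStar with ha
  set x : Fin D.K → ℝ := fun k =>
    (s⁻¹).toReal * ((D.W k).expect u - (D.Y k).expect u) with hx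
  have hcoord : ∀ k, Matrix.toEuclideanLin D.reducedMatrix (M.errorVec u s) k = x k - a k := by
    intro k
    unfold DecisionMaker.errorVec
    rw [← D.expect_sub_expect hb (by
      simp [adjusted, hmle.isUtility.map_zero, M.isUtility_uStar.map_zero])]
    simp only [adjusted, Lottery.expect_mul_sub_div, hx, ha]
    ring
  -- The true pair is feasible, so it is no more likely than the estimate.
  have hlik : ∑ k, ((1 + M.choice k w) / 2 * a k - Real.log (1 + Real.exp (a k))) ≤
      ∑ k, ((1 + M.choice k w) / 2 * x k - Real.log (1 + Real.exp (x k))) := by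
    have h := hmle.isMax M.uStar (ENNReal.ofReal M.sigmaStar) M.isUtility_uStar
      (ENNReal.ofReal_le_ofReal M.le_sigmaStar)
    simp only [logLikelihood, ← Finset.sum_neg_distrib,
      neg_log_one_add_exp (choice_eq_or M _ w)] at h
    rw [← ENNReal.ofReal_inv_of_pos hσ, ENNReal.toReal_ofReal (inv_pos.2 hσ).le] at h
    simpa only [ha, hx, inv_mul_eq_div] using h
  have ha_le : ∀ k, |a k| ≤ c := fun k => by
    have h := Lottery.abs_expect_sub_le hb M.isUtility_uStar (D.W k) (D.Y k)
    rw [ha, abs_div, abs_of_pos hσ]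
    exact (div_le_div_of_nonneg_right h hσ.le).trans (one_div_sigmaStar_le hc M)
  have hx_le : ∀ k, |x k| ≤ c := fun k => by
    have h := Lottery.abs_expect_sub_le hb hmle.isUtility (D.W k) (D.Y k)
    rw [hx, abs_mul, abs_of_nonneg ENNReal.toReal_nonneg]
    exact (mul_le_of_le_one_right ENNReal.toReal_nonneg h).trans (toReal_inv_le hc hmle.le_scale)
  have htan : ∑ k, (Real.sigmoid (a k) * (x k - a k) + omegaConst c / 2 * (x k - a k) ^ 2) ≤
      ∑ k, (Real.log (1 + Real.exp (x k)) - Real.log (1 + Real.exp (a k))) :=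
    Finset.sum_le_sum fun k _ => softplus_tangent hc (hx_le k) (ha_le k)
  rw [real_inner_comm, inner_residualVec, EuclideanSpace.real_norm_sq_eq, Finset.mul_sum]
  simp only [hcoord]
  -- Here (1 + Z_k)/2 is the choice indicator; subtracting the slope sigmoid (a k) of the tangent
  -- leaves the residual.
  have hres : ∀ k, (x k - a k) * M.residual k w =
      (1 + M.choice k w) / 2 * x k - (1 + M.choice k w) / 2 * a k -
        Real.sigmoid (a k) * (x k - a k) := fun k => by
    rw [choice_eq]
    ring
  simp only [hres, Finset.sum_sub_distrib, Finset.sum_add_distrib] at *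
  linarith

/-- Cauchy–Schwarz after projecting v onto S, so that the noise counts dim S coordinates and not the
ambient dimension. -/
lemma inner_le_sqrt_sum_mul_norm {E ι : Type*} [NormedAddCommGroup E] [InnerProductSpace ℝ E]
    [Fintype ι] {S : Submodule ℝ E} (e : OrthonormalBasis ι ℝ S) (v : E) {x : E} (hx : x ∈ S) :
    inner ℝ v x ≤ √(∑ i, inner ℝ (e i : E) v ^ 2) * ‖x‖ := by
  have h1 : x = ∑ i, inner ℝ (e i : E) x • (e i : E) := by
    have := congrArg Subtype.val (e.sum_repr' ⟨x, hx⟩)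
    simpa using this.symm
  have h2 : ∑ i, inner ℝ (e i : E) x ^ 2 = ‖x‖ ^ 2 := by
    have := e.sum_sq_norm_inner_right ⟨x, hx⟩
    simpa using this
  calc inner ℝ v x = ∑ i, inner ℝ (e i : E) v * inner ℝ (e i : E) x := by
        conv_lhs => rw [h1]
        rw [inner_sum]
        refine Finset.sum_congr rfl fun i _ => ?_
        rw [real_inner_smul_right, real_inner_comm v, mul_comm]
    _ ≤ √(∑ i, inner ℝ (e i : E) v ^ 2) * √(∑ i, inner ℝ (e i : E) x ^ 2) :=
        Real.sum_mul_le_sqrt_mul_sqrt _ _ _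
    _ = √(∑ i, inner ℝ (e i : E) v ^ 2) * ‖x‖ := by rw [h2, Real.sqrt_sq (norm_nonneg _)]

/-- The error at the breakpoints controls the Kolmogorov distance. -/
lemma kolmogorovDist_le_norm_errorVec (hb : 0 < b) (hL : 0 < L) (hc : 0 < c)
    (M : DecisionMaker L c D P) {u : ℝ → ℝ} (hu : IsUtility b L u) (s : ℝ≥0∞) :
    kolmogorovDist b (adjusted u s) (fun y => M.uStar y / M.sigmaStar) ≤
      L * c * D.mesh + ‖M.errorVec u s‖ := by
  have hσ := sigmaStar_pos hc M
  refine D.kolmogorovDist_le hb (by positivity)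
    (fun x hx y hy h => mul_le_mul_of_nonneg_left (hu.mono hx hy h) ENNReal.toReal_nonneg)
    (fun x hx y hy h => div_le_div_of_nonneg_right (M.isUtility_uStar.mono hx hy h) hσ.le)
    (fun x hx y hy h => ?_) fun j => ?_
  · have h1 := M.isUtility_uStar.sub_le hL hx hy h
    have h2 := one_div_sigmaStar_le hc M
    calc M.uStar y / M.sigmaStar - M.uStar x / M.sigmaStar
        = (M.uStar y - M.uStar x) * (1 / M.sigmaStar) := by ring
      _ ≤ (L * (y - x)) * c := mul_le_mul h1 h2 (by positivity)
          (mul_nonneg hL.le (sub_nonneg.2 h))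
      _ = L * c * (y - x) := by ring
  · obtain ⟨j, hj⟩ := j
    cases j with
    -- The first breakpoint has no coordinate in `errorVec`, but both utilities vanish there.
    | zero =>
      rw [D.breakpoint_zero hb hj]
      simp [adjusted, hu.map_zero, M.isUtility_uStar.map_zero]
    | succ j => exact PiLp.norm_apply_le (M.errorVec u s) ⟨j, by omega⟩

lemma errorLE_mono (M : DecisionMaker L c D P) {r r' : ℝ} (h : r ≤ r') :
    M.errorLE r ⊆ M.errorLE r' :=
  fun _ hw u s hmle => (hw u s hmle).trans h

/-- High-probability error bound for maximum likelihood estimates. -/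
lemma le_prob_errorLE [IsProbabilityMeasure P] (hb : 0 < b) (hL : 0 < L) (hc : 0 < c)
    (M : DecisionMaker L c D P) (hlam : 0 < lambdaMin D.infoMatrix) {δ : ℝ} (hδ : 0 < δ) :
    ENNReal.ofReal (1 - δ) ≤ P (M.errorLE (L * c * D.mesh + 2 / √(lambdaMin D.infoMatrix) *
      √(((D.N : ℝ) - 1 - Real.log δ) / (omegaConst c ^ 2 * D.K)))) := by
  set T := Matrix.toEuclideanLin D.reducedMatrix
  set lam := lambdaMin D.infoMatrix
  have hK : (0 : ℝ) < D.K := by exact_mod_cast D.K_pos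
  have hω := omegaConst_pos c
  have hN := D.two_le_N hb
  set e := stdOrthonormalBasis ℝ (LinearMap.range T)
  have hdim : (Module.finrank ℝ (LinearMap.range T) : ℝ) ≤ (D.N : ℝ) - 1 := by
    have h := LinearMap.finrank_range_le T
    rw [finrank_euclideanSpace_fin] at h
    have h' : ((D.N - 1 : ℕ) : ℝ) = (D.N : ℝ) - 1 := by push_cast [show 1 ≤ D.N by omega]; rfl
    exact (Nat.cast_le.2 h).trans_eq h'
  -- The event involves the residuals alone. The rest is deterministic on it, hence uniform over all
  -- estimates.
  refine (le_prob_sum_sq_le (measurable_inner_residualVec M)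
    (lintegral_exp_inner_residualVec_le hc M)
    (e.orthonormal.comp_linearIsometry (LinearMap.range T).subtypeₗᵢ) hδ).trans
    (measure_mono fun w hw u s hmle => ?_)
  simp only [Function.comp_apply, Submodule.coe_subtypeₗᵢ, Submodule.subtype_apply,
    Fintype.card_fin, Set.mem_ofPred_eq] at hw
  refine (kolmogorovDist_le_norm_errorVec hb hL hc M hmle.isUtility s).trans ?_
  set Δ := M.errorVec u s
  set Q := ∑ i, inner ℝ (e i : EuclideanSpace ℝ (Fin D.K)) (M.residualVec w) ^ 2
  have h1 : omegaConst c / 2 * ‖T Δ‖ ^ 2 ≤ √Q * ‖T Δ‖ :=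
    (basic_inequality hb hc M hmle).trans
      (inner_le_sqrt_sum_mul_norm e _ (LinearMap.mem_range_self T Δ))
  have h2 : ‖T Δ‖ ≤ 2 / omegaConst c * √Q := by
    rcases (norm_nonneg (T Δ)).eq_or_lt with h0 | h0
    · rw [← h0]; positivity
    · have h3 : omegaConst c / 2 * ‖T Δ‖ ≤ √Q := by
        rw [pow_two, ← mul_assoc] at h1
        exact le_of_mul_le_mul_right h1 h0
      rw [div_mul_eq_mul_div, le_div_iff₀ hω]
      linarith
  have h4 : √(lam * D.K) * ‖Δ‖ ≤ ‖T Δ‖ := by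
    rw [← Real.sqrt_sq (norm_nonneg Δ), ← Real.sqrt_mul (by positivity),
      Real.sqrt_le_left (norm_nonneg _)]
    exact lambdaMin_infoMatrix_mul_le D Δ
  have h5 : √Q ≤ √((D.N : ℝ) - 1 - Real.log δ) := Real.sqrt_le_sqrt (by linarith)
  have h6 : ‖Δ‖ ≤ 2 / √lam * √(((D.N : ℝ) - 1 - Real.log δ) / (omegaConst c ^ 2 * D.K)) := by
    rw [Real.sqrt_div' _ (by positivity), Real.sqrt_mul (sq_nonneg _), Real.sqrt_sq hω.le,
      div_mul_div_comm, le_div_iff₀ (by positivity)]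
    rw [Real.sqrt_mul hlam.le] at h4
    calc ‖Δ‖ * (√lam * (omegaConst c * √D.K))
        = omegaConst c * (√lam * √D.K * ‖Δ‖) := by ring
      _ ≤ omegaConst c * (2 / omegaConst c * √Q) :=
          mul_le_mul_of_nonneg_left (h4.trans h2) hω.le
      _ = 2 * √Q := by field_simp
      _ ≤ 2 * √((D.N : ℝ) - 1 - Real.log δ) := by linarith
  linarith

/-- The constant in front of the statistical error. -/
noncomputable def rateConst (c δ : ℝ) : ℝ := 2 * √(1 - Real.log δ) / omegaConst c

lemma rateConst_nonneg (c δ : ℝ) : 0 ≤ rateConst c δ := by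
  have := omegaConst_pos c
  unfold rateConst; positivity

/-- The high-probability error bound with the number of breakpoints factored out. -/
lemma le_prob_errorLE_rate [IsProbabilityMeasure P] (hb : 0 < b) (hL : 0 < L) (hc : 0 < c)
    (M : DecisionMaker L c D P) (hlam : 0 < lambdaMin D.infoMatrix) {δ : ℝ} (hδ : 0 < δ)
    (hδ1 : δ < 1) :
    ENNReal.ofReal (1 - δ) ≤ P (M.errorLE (L * c * D.mesh +
      rateConst c δ / √(lambdaMin D.infoMatrix) * √((D.N : ℝ) / D.K))) := by
  refine (le_prob_errorLE hb hL hc M hlam hδ).trans (measure_mono (errorLE_mono M ?_))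
  have hK : (0 : ℝ) < D.K := by exact_mod_cast D.K_pos
  have hω := omegaConst_pos c
  have hN : (2 : ℝ) ≤ D.N := by exact_mod_cast D.two_le_N hb
  have hlog : Real.log δ < 0 := Real.log_neg hδ hδ1
  -- Uses N - 1 - log δ ≤ (1 - log δ) N, valid because N ≥ 1 and log δ < 0.
  have h1 : √(((D.N : ℝ) - 1 - Real.log δ) / (omegaConst c ^ 2 * D.K)) ≤
      √(1 - Real.log δ) / omegaConst c * √((D.N : ℝ) / D.K) := by
    rw [← Real.sqrt_sq hω.le, ← Real.sqrt_div' _ (sq_nonneg _), ← Real.sqrt_mul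
      (div_nonneg (by linarith) (sq_nonneg _)), Real.sqrt_sq hω.le, div_mul_div_comm]
    refine Real.sqrt_le_sqrt (div_le_div_of_nonneg_right ?_ (by positivity))
    nlinarith
  calc L * c * D.mesh + 2 / √(lambdaMin D.infoMatrix) *
        √(((D.N : ℝ) - 1 - Real.log δ) / (omegaConst c ^ 2 * D.K))
      ≤ L * c * D.mesh + 2 / √(lambdaMin D.infoMatrix) *
        (√(1 - Real.log δ) / omegaConst c * √((D.N : ℝ) / D.K)) := by gcongr
    _ = _ := by rw [rateConst]; ring

/-- Both adjusted utilities take values in `[0, c]`, so that the error never exceeds `c`. This a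
priori bound holds whatever the rank of the information matrix is. -/
lemma errorLE_eq_univ (hb : 0 < b) (hc : 0 < c) (M : DecisionMaker L c D P) :
    M.errorLE c = Set.univ := by
  refine Set.eq_univ_of_forall fun w u s hmle => ?_
  have hσ := sigmaStar_pos hc M
  have : Nonempty (Set.Icc (0 : ℝ) b) := ⟨⟨0, le_rfl, hb.le⟩⟩
  refine ciSup_le fun ⟨y, hy⟩ => ?_
  obtain ⟨h1, h2⟩ := hmle.isUtility.mem_Icc hb hy
  obtain ⟨h3, h4⟩ := M.isUtility_uStar.mem_Icc hb hy
  have h5 : adjusted u s y ≤ c :=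
    (mul_le_of_le_one_right ENNReal.toReal_nonneg h2).trans (toReal_inv_le hc hmle.le_scale)
  have h6 : 0 ≤ adjusted u s y := mul_nonneg ENNReal.toReal_nonneg h1
  have h7 : M.uStar y / M.sigmaStar ≤ c :=
    (div_le_div_of_nonneg_right h4 hσ.le).trans (one_div_sigmaStar_le hc M)
  have h8 : 0 ≤ M.uStar y / M.sigmaStar := div_nonneg h3 hσ.le
  exact abs_le.2 ⟨by linarith, by linarith⟩

end MLE

lemma tendsto_one_of_eventually_le {f : ℕ → ℝ≥0∞} (h1 : ∀ n, f n ≤ 1)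
    (h : ∀ δ : ℝ, 0 < δ → δ < 1 → ∀ᶠ n in atTop, ENNReal.ofReal (1 - δ) ≤ f n) :
    Tendsto f atTop (𝓝 1) := by
  refine tendsto_order.2 ⟨fun a ha => ?_, fun a ha => Eventually.of_forall fun n =>
    (h1 n).trans_lt ha⟩
  have hat : a ≠ ∞ := (ha.trans ENNReal.one_lt_top).ne
  have ha1 : a.toReal < 1 := by
    rw [← ENNReal.toReal_one]
    exact (ENNReal.toReal_lt_toReal hat ENNReal.one_ne_top).2 ha
  have ha0 : 0 ≤ a.toReal := ENNReal.toReal_nonneg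
  -- With this δ, 1 - δ is the midpoint of a and 1, hence above a.
  filter_upwards [h ((1 - a.toReal) / 2) (by linarith) (by linarith)] with n hn
  refine lt_of_lt_of_le ?_ hn
  exact (ENNReal.lt_ofReal_iff_toReal_lt hat).2 (by linarith)

end PrefElicit

theorem mainTheorem6 :
    -- (a), explicit bound
    (∀ (b L c : ℝ), 0 < b → 0 < L → 0 < c →
      ∀ (D : PrefElicit.Questionnaire b) (Ω : Type*) [MeasurableSpace Ω]
        (P : Measure Ω) [IsProbabilityMeasure P] (M : PrefElicit.DecisionMaker L c D P)
        (lam : ℝ), PrefElicit.lambdaMin D.infoMatrix = lam → 0 < lam →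
      ∀ δ : ℝ, 0 < δ → δ < 1 →
        ENNReal.ofReal (1 - δ) ≤ P (M.errorLE
          (L * c * D.mesh + 2 / √lam *
            √((((D.N : ℝ) - 1) + 2 * √(-((D.N : ℝ) - 1) * Real.log δ) - 2 * Real.log δ) /
              (PrefElicit.omegaConst c ^ 2 * (D.K : ℝ)))))) ∧
    -- (a), rate for a dense support set, with the dependence on the smallest eigenvalue explicit
    (∀ (L c A : ℝ), 0 < L → 0 < c →
      ∃ C₁ : ℝ, ∀ δ : ℝ, 0 < δ → δ < 1 → ∃ C₂ : ℝ,
      ∀ (b : ℝ), 0 < b →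
      ∀ (D : PrefElicit.Questionnaire b) (Ω : Type*) [MeasurableSpace Ω]
        (P : Measure Ω) [IsProbabilityMeasure P] (M : PrefElicit.DecisionMaker L c D P)
        (lam : ℝ), PrefElicit.lambdaMin D.infoMatrix = lam → 0 < lam →
        D.mesh ≤ A / (D.N : ℝ) →
        ENNReal.ofReal (1 - δ) ≤ P (M.errorLE
          (C₁ / (D.N : ℝ) + C₂ / √lam * √((D.N : ℝ) / (D.K : ℝ))))) ∧
    -- (a), convergence in probability
    (∀ (b L c : ℝ), 0 < b → 0 < L → 0 < c →
      ∀ (D : ℕ → PrefElicit.Questionnaire b) (Ω : ℕ → Type*) [∀ n, MeasurableSpace (Ω n)]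
        (P : ∀ n, Measure (Ω n)) [∀ n, IsProbabilityMeasure (P n)]
        (M : ∀ n, PrefElicit.DecisionMaker L c (D n) (P n))
        (lam : ℕ → ℝ), (∀ n, PrefElicit.lambdaMin (D n).infoMatrix = lam n) → (∀ n, 0 < lam n) →
        ((fun n => (D n).mesh) =O[atTop] fun n => 1 / ((D n).N : ℝ)) →
        Tendsto (fun n => (D n).N) atTop atTop →
        Tendsto (fun n => (D n).K) atTop atTop →
        ((fun n => ((D n).N : ℝ)) =o[atTop] fun n => lam n * ((D n).K : ℝ)) →
        ∀ η : ℝ, 0 < η → Tendsto (fun n => P n ((M n).errorLE η)) atTop (𝓝 1)) ∧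
    -- (a), convergence for eigenvalues bounded below: the statistical error vanishes if `N = o(K)`
    (∀ (b L c A : ℝ), 0 < b → 0 < L → 0 < c →
      ∀ (D : ℕ → PrefElicit.Questionnaire b) (Ω : ℕ → Type*) [∀ n, MeasurableSpace (Ω n)]
        (P : ∀ n, Measure (Ω n)) [∀ n, IsProbabilityMeasure (P n)]
        (M : ∀ n, PrefElicit.DecisionMaker L c (D n) (P n))
        (lam : ℝ), 0 < lam → (∀ n, lam ≤ PrefElicit.lambdaMin (D n).infoMatrix) →
        (∀ n, (D n).mesh ≤ A / ((D n).N : ℝ)) →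
        ((fun n => ((D n).N : ℝ)) =o[atTop] fun n => ((D n).K : ℝ)) →
        ∀ η : ℝ, 0 < η →
          Tendsto (fun n => P n ((M n).errorLE (L * c * A / ((D n).N : ℝ) + η))) atTop (𝓝 1)) ∧
    -- (b), rank-deficient case
    (∃ C₃ : ℝ, ∀ (L c A : ℝ), 0 < L → 0 < c →
      ∃ C₁ : ℝ, ∀ δ : ℝ, 0 < δ → δ < 1 → ∃ C₂ : ℝ,
      ∀ (b : ℝ), 0 < b →
      ∀ (D : PrefElicit.Questionnaire b) (Ω : Type*) [MeasurableSpace Ω]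
        (P : Measure Ω) [IsProbabilityMeasure P] (M : PrefElicit.DecisionMaker L c D P),
        PrefElicit.lambdaMin D.infoMatrix = 0 →
        D.mesh ≤ A / (D.N : ℝ) →
        ENNReal.ofReal (1 - δ) ≤ P (M.errorLE
          (C₁ / (D.N : ℝ) + C₂ * √((D.N : ℝ) / (D.K : ℝ)) + C₃ * (c * √(D.N : ℝ))))) := by
  refine ⟨?_, ?_, ?_, ?_, ?_⟩
  · rintro b L c hb hL hc D Ω _ P _ M _ rfl hlam δ hδ hδ1
    refine (PrefElicit.le_prob_errorLE hb hL hc M hlam hδ).trans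
      (measure_mono (PrefElicit.errorLE_mono M ?_))
    have hlog : Real.log δ < 0 := Real.log_neg hδ hδ1
    have hs := Real.sqrt_nonneg (-((D.N : ℝ) - 1) * Real.log δ)
    -- The bound already proved is sharper: the target adds a nonnegative root and a second -log δ >
    -- 0.
    have hle : (D.N : ℝ) - 1 - Real.log δ ≤
        (D.N : ℝ) - 1 + 2 * √(-((D.N : ℝ) - 1) * Real.log δ) - 2 * Real.log δ := by linarith
    gcongr
  · intro L c A hL hc
    refine ⟨L * c * A, fun δ hδ hδ1 => ⟨PrefElicit.rateConst c δ, ?_⟩⟩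
    rintro b hb D Ω _ P _ M _ rfl hlam hmesh
    refine (PrefElicit.le_prob_errorLE_rate hb hL hc M hlam hδ hδ1).trans
      (measure_mono (PrefElicit.errorLE_mono M ?_))
    rw [mul_div_assoc]
    gcongr
  · intro b L c hb hL hc D Ω _ P _ M lam hlam hpos hmesh hN hK hNK η hη
    refine PrefElicit.tendsto_one_of_eventually_le (fun n => prob_le_one) fun δ hδ hδ1 => ?_
    have h1 : Tendsto (fun n => (D n).mesh) atTop (𝓝 0) :=
      hmesh.trans_tendsto
        (tendsto_one_div_atTop_nhds_zero_nat.comp hN)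
    -- The factor 1/√λ is absorbed into the root, so that N = o(λK) applies directly.
    have h2 : Tendsto (fun n => √(((D n).N : ℝ) / (lam n * (D n).K))) atTop (𝓝 0) := by
      have := (Real.continuous_sqrt.tendsto _).comp hNK.tendsto_div_nhds_zero
      simpa [Function.comp_def] using this
    have h3 := (h1.const_mul (L * c)).add (h2.const_mul (PrefElicit.rateConst c δ))
    rw [mul_zero, mul_zero, add_zero] at h3
    filter_upwards [h3.eventually_le_const hη] with n hn
    have hlamn : 0 < PrefElicit.lambdaMin (D n).infoMatrix := by rw [hlam n]; exact hpos n
    refine (PrefElicit.le_prob_errorLE_rate hb hL hc (M n) hlamn hδ hδ1).trans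
      (measure_mono (PrefElicit.errorLE_mono (M n) ?_))
    refine le_trans (le_of_eq ?_) hn
    rw [hlam n, div_mul_eq_mul_div, mul_div_assoc, ← Real.sqrt_div' _ (hpos n).le, div_div,
      mul_comm ((D n).K : ℝ)]
  · intro b L c A hb hL hc D Ω _ P _ M lam hpos hlam hmesh hNK η hη
    refine PrefElicit.tendsto_one_of_eventually_le (fun n => prob_le_one) fun δ hδ hδ1 => ?_
    have h2 : Tendsto (fun n => √(((D n).N : ℝ) / (D n).K)) atTop (𝓝 0) := by
      have := (Real.continuous_sqrt.tendsto _).comp hNK.tendsto_div_nhds_zero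
      simpa [Function.comp_def] using this
    have h3 := h2.const_mul (PrefElicit.rateConst c δ / √lam)
    rw [mul_zero] at h3
    filter_upwards [h3.eventually_le_const hη] with n hn
    refine (PrefElicit.le_prob_errorLE_rate hb hL hc (M n) (hpos.trans_le (hlam n)) hδ hδ1).trans
      (measure_mono (PrefElicit.errorLE_mono (M n) (add_le_add ?_ (le_trans ?_ hn))))
    · rw [mul_div_assoc]
      exact mul_le_mul_of_nonneg_left (hmesh n) (by positivity)
    · have := PrefElicit.rateConst_nonneg c δ
      have := hlam n
      gcongr
  · refine ⟨1, fun L c A hL hc => ⟨0, fun δ hδ hδ1 => ⟨0, ?_⟩⟩⟩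
    intro b hb D Ω _ P _ M _ _
    have hN : (1 : ℝ) ≤ √(D.N : ℝ) := by
      rw [Real.one_le_sqrt]
      exact_mod_cast (one_le_two.trans (D.two_le_N hb))
    have hle : c ≤ 0 / (D.N : ℝ) + 0 * √((D.N : ℝ) / (D.K : ℝ)) + 1 * (c * √(D.N : ℝ)) := by
      have := le_mul_of_one_le_right hc.le hN
      simpa using this
    have huniv := PrefElicit.errorLE_eq_univ hb hc M
    have h := measure_mono (μ := P) (PrefElicit.errorLE_mono M hle)
    rw [huniv, measure_univ] at h
    refine le_trans ?_ h
    rw [← ENNReal.ofReal_one]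
    exact ENNReal.ofReal_le_ofReal (by linarith)
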